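/- Let $K$ be a field, let $n\ge 3$, and let $C_n$ be the cycle graph on the vertex set $\{1,\dots,n\}$. Let $S=K[x_1,\dots,x_n]$ with graded maximal ideal $\mathfrak m=(x_1,\dots,x_n)$, and let $I(C_n)=(x_1x_2,\,x_2x_3,\dots,x_{n-1}x_n,\,x_nx_1)\subset S$ be the edge ideal of $C_n$. Let $\operatorname{depth} S/I(C_n)$ be the maximal length of an $S/I(C_n)$-regular sequence contained in $\mathfrak m$, and say that $C_n$ has maximal depth if $$\operatorname{depth} S/I(C_n)=\min\{\dim S/\mathfrak p:\ \mathfrak p\in\operatorname{Ass}(S/I(C_n))\}.$$ Then $C_n$ has maximal depth if and only if $n\equiv 0 \pmod 3$ or $n\equiv 2\pmod 3$. Moreover, writing $\operatorname{bight} I(C_n)$ for the maximum height of a minimal prime of $I(C_n)$, the equality $\operatorname{depth} S/I(C_n)=n-\operatorname{bight} I(C_n)$ also holds if and only if $n\equiv 0\pmod 3$ or $n\equiv 2\pmod 3$. -/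

import Mathlib

section

variable {R : Type*} [CommRing R]

/-- The depth of `M` with respect to the ideal `m`: the supremum of the lengths of the `M`-regular
sequences contained in `m`. When `R` is a standard graded algebra and `m` is its graded maximal
ideal, this is the usual depth of a nonzero finitely generated graded module `M`. -/
noncomputable def moduleDepth (m : Ideal R) (M : Type*) [AddCommGroup M] [Module R M] : ℕ∞ :=
  ⨆ (rs : List R) (_ : (∀ r ∈ rs, r ∈ m) ∧ RingTheory.Sequence.IsRegular M rs),
    (rs.length : ℕ∞)

/-- `mdepth M`, the minimum of the Krull dimensions `dim R/p`, over the associated primes `p`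
of `M`. -/
noncomputable def moduleMdepth (R : Type*) [CommRing R] (M : Type*) [AddCommGroup M] [Module R M] :
    WithBot ℕ∞ :=
  ⨅ p ∈ associatedPrimes R M, ringKrullDim (R ⧸ p)

/-- `M` has maximal depth (with respect to the maximal ideal `m`) if `depth M = mdepth M`. -/
def HasMaximalDepth (m : Ideal R) (M : Type*) [AddCommGroup M] [Module R M] : Prop :=
  (moduleDepth m M : WithBot ℕ∞) = moduleMdepth R M

/-- The big height of an ideal: the maximum height of its minimal primes. -/
noncomputable def bigHeight (I : Ideal R) : ℕ∞ :=
  ⨆ p ∈ I.minimalPrimes, p.height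

/-- The edge ideal of a graph `G`, generated by the monomials `x_i x_j` with `{i, j}` an edge. -/
noncomputable def edgeIdeal (K : Type*) [Field K] {V : Type*} (G : SimpleGraph V) :
    Ideal (MvPolynomial V K) :=
  Ideal.span {f | ∃ i j, G.Adj i j ∧ f = MvPolynomial.X i * MvPolynomial.X j}

end

/-! ### Ext criteria for depth: Mayer–Vietoris, regular elements, Rees. -/

section ExtVanishing

open CategoryTheory Abelian

universe u

variable {R : Type u} [CommRing R]

/-! The edge ideal of the cycle is the Stanley–Reisner ideal of its independence complex Δ. Three
facts decide both equivalences: the depth is ⌊(n+1)/3⌋; every facet of Δ has at least ⌈n/3⌉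
vertices; and if n ≢ 1 (mod 3), the multiples of 3 form a facet of exactly that size. The associated
primes of S/I_Δ are its minimal primes, one for each facet W, with dim S/p = |W| and height n - |W|.
So both equalities compare ⌊(n+1)/3⌋ with the least facet size. If n ≢ 1, the two numbers agree; if
n ≡ 1, the depth is smaller than ⌈n/3⌉.

The depth is the first nonzero degree of Ext(K, K[Δ]) (`moduleDepth_eq_of_ext`). A union of
complexes gives a Mayer–Vietoris sequence, with K[Δ ∩ Γ] shifted by one degree, and a cone raises
the vanishing bound by one (`FaceExtVanishesBelow.cone`). Splitting paths and cycles into stars and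
deletions gives vanishing below ⌊(n+1)/3⌋. For nonvanishing, the cycle complex is written as the
star of one vertex together with the stars of its two neighbours. The intersection is the complex of
a cycle shorter by three, so a nonzero class climbs one degree for every three vertices
(`faceExtNontrivial_cycleComplex`). -/

/-- The groups `Ext^i(N, M)` vanish for all `i < d`. -/
def ExtVanishesBelow (N M : ModuleCat.{u} R) (d : ℕ) : Prop :=
  ∀ i < d, Subsingleton (Ext N M i)

theorem ExtVanishesBelow.mono {N M : ModuleCat.{u} R} {d e : ℕ} (h : ExtVanishesBelow N M d)
    (hed : e ≤ d) : ExtVanishesBelow N M e :=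
  fun i hi => h i (hi.trans_le hed)

theorem subsingleton_ext_prod {N : ModuleCat.{u} R} {A B : Type u} [AddCommGroup A] [Module R A]
    [AddCommGroup B] [Module R B] {i : ℕ} (hA : Subsingleton (Ext N (ModuleCat.of R A) i))
    (hB : Subsingleton (Ext N (ModuleCat.of R B) i)) :
    Subsingleton (Ext N (ModuleCat.of R (A × B)) i) := by
  have hid : 𝟙 (ModuleCat.of R (A × B)) =
      ModuleCat.ofHom (LinearMap.fst R A B) ≫ ModuleCat.ofHom (LinearMap.inl R A B) +
      ModuleCat.ofHom (LinearMap.snd R A B) ≫ ModuleCat.ofHom (LinearMap.inr R A B) := by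
    ext x <;> simp
  refine subsingleton_of_forall_eq 0 fun x => ?_
  rw [← Ext.comp_mk₀_id x, hid, Ext.mk₀_add, Ext.comp_add, ← Ext.mk₀_comp_mk₀,
    ← Ext.mk₀_comp_mk₀, ← Ext.comp_assoc_of_third_deg_zero, ← Ext.comp_assoc_of_third_deg_zero,
    Subsingleton.elim (x.comp (Ext.mk₀ (ModuleCat.ofHom (LinearMap.fst R A B))) _) 0,
    Subsingleton.elim (x.comp (Ext.mk₀ (ModuleCat.ofHom (LinearMap.snd R A B))) _) 0]
  simp

/-- The map `R/(I ∩ J) → R/I × R/J`. -/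
noncomputable def quotientInfToProd (I J : Ideal R) : (R ⧸ (I ⊓ J)) →ₗ[R] (R ⧸ I) × (R ⧸ J) :=
  (Submodule.factor inf_le_left).prod (Submodule.factor inf_le_right)

/-- The difference map `R/I × R/J → R/(I + J)`. -/
noncomputable def quotientProdToSup (I J : Ideal R) : (R ⧸ I) × (R ⧸ J) →ₗ[R] (R ⧸ (I ⊔ J)) :=
  (Submodule.factor le_sup_left).comp (LinearMap.fst R _ _) -
    (Submodule.factor le_sup_right).comp (LinearMap.snd R _ _)

theorem quotientInfToProd_injective (I J : Ideal R) :
    Function.Injective (quotientInfToProd I J) := by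
  rw [injective_iff_map_eq_zero]
  intro x
  obtain ⟨x, rfl⟩ := Submodule.Quotient.mk_surjective _ x
  intro h
  have h1 : (Submodule.Quotient.mk x : R ⧸ I) = 0 := congrArg Prod.fst h
  have h2 : (Submodule.Quotient.mk x : R ⧸ J) = 0 := congrArg Prod.snd h
  rw [Submodule.Quotient.mk_eq_zero] at h1 h2 ⊢
  exact ⟨h1, h2⟩

theorem quotientProdToSup_surjective (I J : Ideal R) :
    Function.Surjective (quotientProdToSup I J) := by
  intro x
  obtain ⟨x, rfl⟩ := Submodule.Quotient.mk_surjective _ x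
  refine ⟨(Submodule.Quotient.mk x, 0), ?_⟩
  simp [quotientProdToSup]

theorem exact_quotientInfToProd_quotientProdToSup (I J : Ideal R) :
    Function.Exact (quotientInfToProd I J) (quotientProdToSup I J) := by
  rintro ⟨x, y⟩
  obtain ⟨x, rfl⟩ := Submodule.Quotient.mk_surjective _ x
  obtain ⟨y, rfl⟩ := Submodule.Quotient.mk_surjective _ y
  constructor
  · intro h
    have h' : (Submodule.Quotient.mk (x - y) : R ⧸ (I ⊔ J)) = 0 := h
    rw [Submodule.Quotient.mk_eq_zero, Submodule.mem_sup] at h'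
    obtain ⟨a, ha, b, hb, hab⟩ := h'
    refine ⟨Submodule.Quotient.mk (x - a), Prod.ext ?_ ?_⟩
    · change (Submodule.Quotient.mk (x - a) : R ⧸ I) = Submodule.Quotient.mk x
      rw [Submodule.Quotient.eq]
      simpa using I.neg_mem ha
    · change (Submodule.Quotient.mk (x - a) : R ⧸ J) = Submodule.Quotient.mk y
      rw [Submodule.Quotient.eq]
      have : x - a - y = b := by linear_combination -hab
      rwa [this]
  · rintro ⟨z, hz⟩
    obtain ⟨z, rfl⟩ := Submodule.Quotient.mk_surjective _ z
    rw [← hz]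
    change (Submodule.Quotient.mk z - Submodule.Quotient.mk z : R ⧸ (I ⊔ J)) = 0
    exact sub_self _

/-- The Mayer–Vietoris sequence `R/(I ∩ J) → R/I × R/J → R/(I + J)`. -/
noncomputable def mayerVietorisComplex (I J : Ideal R) : ShortComplex (ModuleCat.{u} R) :=
  ModuleCat.shortComplexOfCompEqZero (quotientInfToProd I J) (quotientProdToSup I J)
    (exact_quotientInfToProd_quotientProdToSup I J).linearMap_comp_eq_zero

theorem mayerVietorisComplex_shortExact (I J : Ideal R) :
    (mayerVietorisComplex I J).ShortExact where
  exact := ModuleCat.shortComplex_exact _ (exact_quotientInfToProd_quotientProdToSup I J)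
  mono_f := (ModuleCat.mono_iff_injective _).2 (quotientInfToProd_injective I J)
  epi_g := (ModuleCat.epi_iff_surjective _).2 (quotientProdToSup_surjective I J)

/-- In the long exact sequence, Ext^i of R/(I ∩ J) lies between Ext^(i-1) of R/(I + J) and Ext^i of
R/I × R/J, so the bound for the sum may be one lower. -/
theorem extVanishesBelow_quotient_inf {N : ModuleCat.{u} R} {I J : Ideal R} {d : ℕ}
    (hI : ExtVanishesBelow N (ModuleCat.of R (R ⧸ I)) (d + 1))
    (hJ : ExtVanishesBelow N (ModuleCat.of R (R ⧸ J)) (d + 1))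
    (hIJ : ExtVanishesBelow N (ModuleCat.of R (R ⧸ (I ⊔ J))) d) :
    ExtVanishesBelow N (ModuleCat.of R (R ⧸ (I ⊓ J))) (d + 1) := by
  intro i hi
  have hS := mayerVietorisComplex_shortExact I J
  have hmid : Subsingleton (Ext N (mayerVietorisComplex I J).X₂ i) :=
    subsingleton_ext_prod (hI i hi) (hJ i hi)
  refine subsingleton_of_forall_eq 0 fun x => ?_
  cases i with
  | zero =>
    have := hS.mono_f
    exact Ext.postcomp_mk₀_injective_of_mono N (mayerVietorisComplex I J).f
      (Subsingleton.elim (α := Ext N (mayerVietorisComplex I J).X₂ 0) _ _)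
  | succ i =>
    have hright : Subsingleton (Ext N (mayerVietorisComplex I J).X₃ i) := hIJ i (by omega)
    obtain ⟨y, hy⟩ := Ext.covariant_sequence_exact₁ N hS x
      (Subsingleton.elim (α := Ext N (mayerVietorisComplex I J).X₂ (i + 1)) _ _) rfl
    rw [Subsingleton.elim y 0, Ext.zero_comp] at hy
    exact hy.symm

/-- Since the middle Ext^d vanishes, the connecting map out of Ext^d of R/(I + J) is injective. -/
theorem nontrivial_ext_quotient_inf {N : ModuleCat.{u} R} {I J : Ideal R} {d : ℕ}
    (hI : Subsingleton (Ext N (ModuleCat.of R (R ⧸ I)) d))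
    (hJ : Subsingleton (Ext N (ModuleCat.of R (R ⧸ J)) d))
    (hIJ : Nontrivial (Ext N (ModuleCat.of R (R ⧸ (I ⊔ J))) d)) :
    Nontrivial (Ext N (ModuleCat.of R (R ⧸ (I ⊓ J))) (d + 1)) := by
  have hS := mayerVietorisComplex_shortExact I J
  have hmid : Subsingleton (Ext N (mayerVietorisComplex I J).X₂ d) := subsingleton_ext_prod hI hJ
  by_contra h
  rw [not_nontrivial_iff_subsingleton] at h
  have hleft : Subsingleton (Ext N (mayerVietorisComplex I J).X₁ (d + 1)) := h
  have hright : Nontrivial (Ext N (mayerVietorisComplex I J).X₃ d) := hIJ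
  obtain ⟨x, hx⟩ := exists_ne (0 : Ext N (mayerVietorisComplex I J).X₃ d)
  obtain ⟨y, hy⟩ := Ext.covariant_sequence_exact₃ N hS x rfl (Subsingleton.elim _ _)
  rw [Subsingleton.elim y 0, Ext.zero_comp] at hy
  exact hx hy.symm

/-- If `r` kills `N`, is regular on `M` and `M'` is isomorphic to `M / r M`, then `Ext(N, M)`
vanishes in one degree more than `Ext(N, M')`. -/
theorem ExtVanishesBelow.succ_of_regular {N : ModuleCat.{u} R} {M M' : Type u} [AddCommGroup M]
    [Module R M] [AddCommGroup M'] [Module R M'] {r : R} (hr : r ∈ Module.annihilator R N)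
    (hreg : IsSMulRegular M r) (g : M →ₗ[R] M') (hg : Function.Surjective g)
    (hex : Function.Exact (LinearMap.lsmul R M r) g) {d : ℕ}
    (h : ExtVanishesBelow N (ModuleCat.of R M') d) :
    ExtVanishesBelow N (ModuleCat.of R M) (d + 1) := by
  let S : ShortComplex (ModuleCat.{u} R) :=
    ModuleCat.shortComplexOfCompEqZero (LinearMap.lsmul R M r) g hex.linearMap_comp_eq_zero
  have hS : S.ShortExact :=
    { exact := ModuleCat.shortComplex_exact _ hex
      mono_f := (ModuleCat.mono_iff_injective _).2 hreg
      epi_g := (ModuleCat.epi_iff_surjective _).2 hg }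
  -- Multiplication by r on M and on N induce the same map on Ext, and the latter is zero. Hence
  -- Ext^(i+1)(N, M) is a quotient of Ext^i(N, M').
  have hzero : ∀ (i : ℕ) (x : Ext N S.X₁ i), x.comp (Ext.mk₀ S.f) (add_zero i) = 0 := by
    intro i x
    have hf : S.f = r • 𝟙 S.X₁ := rfl
    have hN : r • 𝟙 N = 0 := by
      ext y
      exact Module.mem_annihilator.1 hr y
    have hx : r • x = (Ext.mk₀ (r • 𝟙 N)).comp x (zero_add i) := by simp [Ext.mk₀_smul]
    rw [hf, ← Ext.smul_eq_comp_mk₀, hx, hN, Ext.mk₀_zero, Ext.zero_comp]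
  intro i hi
  refine subsingleton_of_forall_eq (0 : Ext N S.X₁ i) fun x => ?_
  cases i with
  | zero =>
    have := hS.mono_f
    refine Ext.postcomp_mk₀_injective_of_mono N S.f ?_
    rw [map_zero]
    exact hzero 0 x
  | succ i =>
    have hright : Subsingleton (Ext N S.X₃ i) := h i (by omega)
    obtain ⟨y, hy⟩ := Ext.covariant_sequence_exact₁ N hS x (hzero _ x) rfl
    rw [Subsingleton.elim y 0, Ext.zero_comp] at hy
    exact hy.symm

/-- The depth of `M` is the first degree in which `Ext(R/m, M)` does not vanish. -/
theorem moduleDepth_eq_of_ext [IsNoetherianRing R] {m : Ideal R} {M : Type u} [AddCommGroup M]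
    [Module R M] [Module.Finite R M] (hm : m • (⊤ : Submodule R M) < ⊤) {d : ℕ}
    (hd : ExtVanishesBelow (ModuleCat.of R (R ⧸ m)) (ModuleCat.of R M) d)
    (hne : Nontrivial (Ext (ModuleCat.of R (R ⧸ m)) (ModuleCat.of R M) d)) :
    moduleDepth m M = d := by
  have hsupp : Module.support R (ModuleCat.of R (R ⧸ m)) = PrimeSpectrum.zeroLocus (m : Set R) := by
    rw [Module.support_eq_zeroLocus]
    congr 1
    exact congrArg _ (Ideal.annihilator_quotient (I := m))
  apply le_antisymm
  -- Rees: a regular sequence in m of length greater than d would make Ext^d vanish.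
  · refine iSup₂_le fun rs hrs => ?_
    by_contra! hlt
    have := ModuleCat.subsingleton_ext_of_exists_isRegular m (ModuleCat.of R (R ⧸ m)) hsupp.subset
      (ModuleCat.of R M) hm rs hrs.1 hrs.2 d (by exact_mod_cast hlt)
    exact not_subsingleton _ this
  · obtain ⟨rs, hlen, hrs⟩ := ModuleCat.exists_isRegular_of_exists_subsingleton_ext m d
      (ModuleCat.of R M) hm (ModuleCat.of R (R ⧸ m)) hsupp hd
    rw [← hlen]
    exact le_iSup₂ (f := fun (rs : List R) (_ : (∀ r ∈ rs, r ∈ m) ∧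
      RingTheory.Sequence.IsRegular M rs) => (rs.length : ℕ∞)) rs hrs

end ExtVanishing

/-! ### Stanley–Reisner rings of unions and cones. -/

section StanleyReisner

open MvPolynomial CategoryTheory Abelian

universe u

variable (K : Type u) [Field K] {n : ℕ}

/-- The Stanley–Reisner ideal of a simplicial complex, spanned by the monomials whose support is
not a face. -/
noncomputable def stanleyReisnerIdeal (Δ : LowerSet (Finset (Fin n))) :
    Ideal (MvPolynomial (Fin n) K) :=
  Ideal.span ((fun s => monomial s (1 : K)) '' {m | m.support ∉ Δ})

variable {K}

theorem mem_stanleyReisnerIdeal {Δ : LowerSet (Finset (Fin n))} {f : MvPolynomial (Fin n) K} :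
    f ∈ stanleyReisnerIdeal K Δ ↔ ∀ m ∈ f.support, m.support ∉ Δ := by
  rw [stanleyReisnerIdeal, mem_ideal_span_monomial_image]
  refine forall₂_congr fun m _ => ⟨?_, fun h => ⟨m, h, le_rfl⟩⟩
  rintro ⟨s, hs, hsm⟩ hm
  exact hs (Δ.lower (Finsupp.support_mono hsm) hm)

theorem stanleyReisnerIdeal_le {Δ : LowerSet (Finset (Fin n))}
    {J : Ideal (MvPolynomial (Fin n) K)}
    (h : ∀ m : Fin n →₀ ℕ, m.support ∉ Δ → monomial m (1 : K) ∈ J) :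
    stanleyReisnerIdeal K Δ ≤ J := by
  rw [stanleyReisnerIdeal, Ideal.span_le]
  rintro _ ⟨m, hm, rfl⟩
  exact h m hm

theorem monomial_mem_stanleyReisnerIdeal {Δ : LowerSet (Finset (Fin n))} {m : Fin n →₀ ℕ}
    (hm : m.support ∉ Δ) : monomial m (1 : K) ∈ stanleyReisnerIdeal K Δ :=
  Ideal.subset_span ⟨m, hm, rfl⟩

theorem stanleyReisnerIdeal_anti {Δ Γ : LowerSet (Finset (Fin n))} (h : Δ ≤ Γ) :
    stanleyReisnerIdeal K Γ ≤ stanleyReisnerIdeal K Δ :=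
  stanleyReisnerIdeal_le fun _ hm => monomial_mem_stanleyReisnerIdeal fun hm' => hm (h hm')

theorem stanleyReisnerIdeal_sup (Δ Γ : LowerSet (Finset (Fin n))) :
    stanleyReisnerIdeal K (Δ ⊔ Γ) = stanleyReisnerIdeal K Δ ⊓ stanleyReisnerIdeal K Γ := by
  ext f
  simp only [Ideal.mem_inf, mem_stanleyReisnerIdeal, LowerSet.mem_sup_iff, not_or]
  exact ⟨fun h => ⟨fun m hm => (h m hm).1, fun m hm => (h m hm).2⟩,
    fun h m hm => ⟨h.1 m hm, h.2 m hm⟩⟩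

theorem stanleyReisnerIdeal_inf (Δ Γ : LowerSet (Finset (Fin n))) :
    stanleyReisnerIdeal K (Δ ⊓ Γ) = stanleyReisnerIdeal K Δ ⊔ stanleyReisnerIdeal K Γ := by
  apply le_antisymm
  · refine stanleyReisnerIdeal_le fun m hm => ?_
    by_cases hΔ : m.support ∈ Δ
    · exact Ideal.mem_sup_right (monomial_mem_stanleyReisnerIdeal fun hΓ => hm ⟨hΔ, hΓ⟩)
    · exact Ideal.mem_sup_left (monomial_mem_stanleyReisnerIdeal hΔ)
  · exact sup_le (stanleyReisnerIdeal_anti inf_le_left) (stanleyReisnerIdeal_anti inf_le_right)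

/-- The cone with apex `v` over a complex. -/
def coneComplex (v : Fin n) (Δ : LowerSet (Finset (Fin n))) : LowerSet (Finset (Fin n)) where
  carrier := {F | F.erase v ∈ Δ}
  lower' _ _ hFG hF := Δ.lower (Finset.erase_subset_erase v hFG) hF

theorem mem_coneComplex {v : Fin n} {Δ : LowerSet (Finset (Fin n))} {F : Finset (Fin n)} :
    F ∈ coneComplex v Δ ↔ F.erase v ∈ Δ := Iff.rfl

/-- Multiplying a monomial by x_v changes its support at most at v, which the cone ignores. So x_v
is a nonzerodivisor on the ring of the cone. -/
theorem X_mul_mem_stanleyReisnerIdeal_coneComplex {v : Fin n} {Δ : LowerSet (Finset (Fin n))}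
    {f : MvPolynomial (Fin n) K} (h : X v * f ∈ stanleyReisnerIdeal K (coneComplex v Δ)) :
    f ∈ stanleyReisnerIdeal K (coneComplex v Δ) := by
  rw [mem_stanleyReisnerIdeal] at h ⊢
  intro m hm hmem
  refine h (Finsupp.single v 1 + m) ?_ ?_
  · rw [mem_support_iff, coeff_X_mul]
    exact mem_support_iff.1 hm
  · rw [mem_coneComplex] at hmem ⊢
    convert hmem using 1
    ext i
    simp only [Finset.mem_erase, Finsupp.mem_support_iff, Finsupp.add_apply]
    refine and_congr_right fun hi => ?_
    rw [Finsupp.single_eq_of_ne hi, zero_add]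

theorem le_coneComplex (v : Fin n) (Δ : LowerSet (Finset (Fin n))) : Δ ≤ coneComplex v Δ :=
  fun F hF => Δ.lower (Finset.erase_subset v F) hF

theorem stanleyReisnerIdeal_eq_coneComplex_sup {v : Fin n} {Δ : LowerSet (Finset (Fin n))}
    (hv : ∀ F ∈ Δ, v ∉ F) :
    stanleyReisnerIdeal K Δ = stanleyReisnerIdeal K (coneComplex v Δ) ⊔ Ideal.span {X v} := by
  apply le_antisymm
  · refine stanleyReisnerIdeal_le fun m hm => ?_
    by_cases hvm : v ∈ m.support
    · refine Ideal.mem_sup_right (Ideal.mem_span_singleton.2 ?_)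
      exact (X_dvd_monomial).2 (Or.inr (Finsupp.mem_support_iff.1 hvm))
    · refine Ideal.mem_sup_left (monomial_mem_stanleyReisnerIdeal ?_)
      rwa [mem_coneComplex, Finset.erase_eq_of_notMem hvm]
  · refine sup_le (stanleyReisnerIdeal_anti (le_coneComplex v Δ)) ?_
    rw [Ideal.span_singleton_le_iff_mem]
    refine monomial_mem_stanleyReisnerIdeal fun h => hv _ h ?_
    simp

variable (K)

/-- The groups `Ext^i(K, K[Δ])` vanish for all `i < d`, where `K[Δ]` is the Stanley–Reisner ring
of the complex `Δ`. -/
def FaceExtVanishesBelow (Δ : LowerSet (Finset (Fin n))) (d : ℕ) : Prop :=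
  ExtVanishesBelow (ModuleCat.of (MvPolynomial (Fin n) K)
      (MvPolynomial (Fin n) K ⧸ idealOfVars (Fin n) K))
    (ModuleCat.of _ (MvPolynomial (Fin n) K ⧸ stanleyReisnerIdeal K Δ)) d

/-- The group `Ext^d(K, K[Δ])` does not vanish. -/
def FaceExtNontrivial (Δ : LowerSet (Finset (Fin n))) (d : ℕ) : Prop :=
  Nontrivial (Ext (ModuleCat.of (MvPolynomial (Fin n) K)
      (MvPolynomial (Fin n) K ⧸ idealOfVars (Fin n) K))
    (ModuleCat.of _ (MvPolynomial (Fin n) K ⧸ stanleyReisnerIdeal K Δ)) d)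

variable {K}

theorem FaceExtVanishesBelow.zero (Δ : LowerSet (Finset (Fin n))) : FaceExtVanishesBelow K Δ 0 :=
  fun _ hi => absurd hi (Nat.not_lt_zero _)

theorem FaceExtVanishesBelow.mono {Δ : LowerSet (Finset (Fin n))} {d e : ℕ}
    (h : FaceExtVanishesBelow K Δ d) (hed : e ≤ d) : FaceExtVanishesBelow K Δ e :=
  ExtVanishesBelow.mono h hed

theorem FaceExtVanishesBelow.sup {Δ Γ : LowerSet (Finset (Fin n))} {d : ℕ}
    (hΔ : FaceExtVanishesBelow K Δ (d + 1)) (hΓ : FaceExtVanishesBelow K Γ (d + 1))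
    (h : FaceExtVanishesBelow K (Δ ⊓ Γ) d) : FaceExtVanishesBelow K (Δ ⊔ Γ) (d + 1) := by
  unfold FaceExtVanishesBelow at *
  rw [stanleyReisnerIdeal_inf] at h
  rw [stanleyReisnerIdeal_sup]
  exact extVanishesBelow_quotient_inf hΔ hΓ h

theorem FaceExtNontrivial.sup {Δ Γ : LowerSet (Finset (Fin n))} {d : ℕ}
    (hΔ : FaceExtVanishesBelow K Δ (d + 1)) (hΓ : FaceExtVanishesBelow K Γ (d + 1))
    (h : FaceExtNontrivial K (Δ ⊓ Γ) d) : FaceExtNontrivial K (Δ ⊔ Γ) (d + 1) := by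
  unfold FaceExtNontrivial at *
  rw [stanleyReisnerIdeal_inf] at h
  rw [stanleyReisnerIdeal_sup]
  exact nontrivial_ext_quotient_inf (hΔ d d.lt_succ_self) (hΓ d d.lt_succ_self) h

/-- The apex variable is regular on the ring of the cone and kills K; as v is not a vertex of Δ,
dividing by it leaves K[Δ]. -/
theorem FaceExtVanishesBelow.cone {v : Fin n} {Δ : LowerSet (Finset (Fin n))} {d : ℕ}
    (hv : ∀ F ∈ Δ, v ∉ F) (h : FaceExtVanishesBelow K Δ d) :
    FaceExtVanishesBelow K (coneComplex v Δ) (d + 1) := by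
  have hle := stanleyReisnerIdeal_anti (K := K) (le_coneComplex v Δ)
  refine ExtVanishesBelow.succ_of_regular (r := X v) ?_ ?_ (Submodule.factor hle)
    (Submodule.factor_surjective hle) ?_ h
  · change X v ∈ Module.annihilator (MvPolynomial (Fin n) K)
      (MvPolynomial (Fin n) K ⧸ idealOfVars (Fin n) K)
    rw [Ideal.annihilator_quotient]
    exact Ideal.subset_span ⟨v, rfl⟩
  · rw [isSMulRegular_iff_right_eq_zero_of_smul]
    intro f hf
    obtain ⟨f, rfl⟩ := Submodule.Quotient.mk_surjective _ f
    rw [← Submodule.Quotient.mk_smul, Submodule.Quotient.mk_eq_zero] at hf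
    rw [Submodule.Quotient.mk_eq_zero]
    exact X_mul_mem_stanleyReisnerIdeal_coneComplex hf
  · intro f
    obtain ⟨f, rfl⟩ := Submodule.Quotient.mk_surjective _ f
    change (Submodule.Quotient.mk f : _ ⧸ stanleyReisnerIdeal K Δ) = 0 ↔ _
    rw [Submodule.Quotient.mk_eq_zero, stanleyReisnerIdeal_eq_coneComplex_sup hv, Submodule.mem_sup]
    constructor
    · rintro ⟨a, ha, b, hb, rfl⟩
      obtain ⟨c, rfl⟩ := Ideal.mem_span_singleton.1 hb
      refine ⟨Submodule.Quotient.mk c, ?_⟩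
      rw [LinearMap.lsmul_apply, ← Submodule.Quotient.mk_smul, Submodule.Quotient.eq, smul_eq_mul]
      simpa using (Ideal.neg_mem_iff _).2 ha
    · rintro ⟨c, hc⟩
      obtain ⟨c, rfl⟩ := Submodule.Quotient.mk_surjective _ c
      rw [LinearMap.lsmul_apply, ← Submodule.Quotient.mk_smul, Submodule.Quotient.eq,
        smul_eq_mul] at hc
      exact ⟨f - X v * c, by simpa using (Ideal.neg_mem_iff _).2 hc, X v * c,
        Ideal.mem_span_singleton.2 (dvd_mul_right _ _), by ring⟩

theorem mem_idealOfVars_iff {f : MvPolynomial (Fin n) K} :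
    f ∈ idealOfVars (Fin n) K ↔ ∀ m ∈ f.support, m ≠ 0 := by
  rw [idealOfVars, ← Set.image_univ, mem_ideal_span_X_image]
  simp [Finsupp.ext_iff]

theorem idealOfVars_ne_top : idealOfVars (Fin n) K ≠ ⊤ := by
  rw [Ne, Ideal.eq_top_iff_one, mem_idealOfVars_iff]
  intro h
  exact h 0 (by simp) rfl

theorem stanleyReisnerIdeal_le_idealOfVars {Δ : LowerSet (Finset (Fin n))} (h : ∅ ∈ Δ) :
    stanleyReisnerIdeal K Δ ≤ idealOfVars (Fin n) K := by
  intro f hf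
  rw [mem_stanleyReisnerIdeal] at hf
  rw [mem_idealOfVars_iff]
  rintro m hm rfl
  exact hf 0 hm (by simpa using h)

/-- Here the Stanley–Reisner ring is K itself, and the identity is a nonzero element of Hom(K, K).
-/
theorem FaceExtNontrivial.zero {Δ : LowerSet (Finset (Fin n))} (h : ∀ F, F ∈ Δ ↔ F = ∅) :
    FaceExtNontrivial K Δ 0 := by
  have hΔ : stanleyReisnerIdeal K Δ = idealOfVars (Fin n) K := by
    ext f
    rw [mem_stanleyReisnerIdeal, mem_idealOfVars_iff]
    simp [h]
  unfold FaceExtNontrivial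
  rw [hΔ]
  set N := ModuleCat.of (MvPolynomial (Fin n) K) (MvPolynomial (Fin n) K ⧸ idealOfVars (Fin n) K)
  have hN : Nontrivial N := Ideal.Quotient.nontrivial_iff.2 idealOfVars_ne_top
  refine ⟨Ext.mk₀ (𝟙 N), 0, ?_⟩
  rw [Ne, Ext.mk₀_eq_zero_iff]
  intro h0
  obtain ⟨x, hx⟩ := exists_ne (0 : N)
  exact hx (congrArg (fun φ : N ⟶ N => φ.hom x) h0)

theorem moduleDepth_eq_of_face_ext {Δ : LowerSet (Finset (Fin n))} {d : ℕ} (hΔ : ∅ ∈ Δ)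
    (hd : FaceExtVanishesBelow K Δ d) (hne : FaceExtNontrivial K Δ d) :
    moduleDepth (idealOfVars (Fin n) K) (MvPolynomial (Fin n) K ⧸ stanleyReisnerIdeal K Δ) = d := by
  refine moduleDepth_eq_of_ext (lt_top_iff_ne_top.2 fun htop => ?_) hd hne
  have hle : (idealOfVars (Fin n) K) • (⊤ : Submodule (MvPolynomial (Fin n) K)
      (MvPolynomial (Fin n) K ⧸ stanleyReisnerIdeal K Δ)) ≤
      Submodule.map (Submodule.mkQ (stanleyReisnerIdeal K Δ)) (idealOfVars (Fin n) K) := by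
    rw [Submodule.smul_le]
    rintro r hr x -
    obtain ⟨x, rfl⟩ := Submodule.Quotient.mk_surjective _ x
    exact ⟨r * x, Ideal.mul_mem_right _ _ hr, rfl⟩
  rw [htop, top_le_iff] at hle
  have h1 : Submodule.Quotient.mk 1 ∈ Submodule.map (Submodule.mkQ (stanleyReisnerIdeal K Δ))
    (idealOfVars (Fin n) K) := hle ▸ Submodule.mem_top
  obtain ⟨y, hy, hy1⟩ := h1
  rw [Submodule.mkQ_apply, Submodule.Quotient.eq] at hy1
  refine idealOfVars_ne_top (K := K) (n := n) ((Ideal.eq_top_iff_one _).2 ?_)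
  have := Ideal.sub_mem _ hy (stanleyReisnerIdeal_le_idealOfVars hΔ hy1)
  simpa using this

end StanleyReisner

/-! ### Independence complexes of paths and cycles, and their decompositions. -/

section PathsAndCycles

open MvPolynomial

universe u

variable {n : ℕ}

/-- The natural number `k` is an element of `F`. -/
def HasVertex (F : Finset (Fin n)) (k : ℕ) : Prop := ∃ i ∈ F, (i : ℕ) = k

theorem HasVertex.mono {F G : Finset (Fin n)} (h : F ⊆ G) {k : ℕ} (hk : HasVertex F k) :
    HasVertex G k :=
  let ⟨i, hi, hik⟩ := hk
  ⟨i, h hi, hik⟩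

theorem hasVertex_coe {F : Finset (Fin n)} {i : Fin n} : HasVertex F i ↔ i ∈ F := by
  simp [HasVertex, Fin.val_inj]

theorem hasVertex_erase {F : Finset (Fin n)} {v : Fin n} {k : ℕ} :
    HasVertex (F.erase v) k ↔ k ≠ v ∧ HasVertex F k := by
  simp only [HasVertex, Finset.mem_erase]
  constructor
  · rintro ⟨i, ⟨hiv, hi⟩, rfl⟩
    exact ⟨fun h => hiv (Fin.ext h), i, hi, rfl⟩
  · rintro ⟨hkv, i, hi, rfl⟩
    exact ⟨i, ⟨fun h => hkv (congrArg _ h), hi⟩, rfl⟩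

/-- The independence complex of the path with vertices `a, …, b - 1`. -/
def pathComplex (n a b : ℕ) : LowerSet (Finset (Fin n)) where
  carrier := {F | ∀ k, HasVertex F k → a ≤ k ∧ k < b ∧ ¬ HasVertex F (k + 1)}
  lower' _ _ hFG hF k hk :=
    let ⟨h1, h2, h3⟩ := hF k (hk.mono hFG)
    ⟨h1, h2, fun h => h3 (h.mono hFG)⟩

/-- The independence complex of the cycle with vertices `a, …, b - 1`. -/
def cycleComplex (n a b : ℕ) : LowerSet (Finset (Fin n)) where
  carrier := {F | F ∈ pathComplex n a b ∧ ¬ (HasVertex F a ∧ HasVertex F (b - 1))}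
  lower' _ _ hFG hF :=
    ⟨(pathComplex n a b).lower hFG hF.1, fun h => hF.2 ⟨h.1.mono hFG, h.2.mono hFG⟩⟩

theorem mem_pathComplex {a b : ℕ} {F : Finset (Fin n)} :
    F ∈ pathComplex n a b ↔ ∀ k, HasVertex F k → a ≤ k ∧ k < b ∧ ¬ HasVertex F (k + 1) := Iff.rfl

theorem mem_cycleComplex {a b : ℕ} {F : Finset (Fin n)} :
    F ∈ cycleComplex n a b ↔ (∀ k, HasVertex F k → a ≤ k ∧ k < b ∧ ¬ HasVertex F (k + 1)) ∧
      ¬ (HasVertex F a ∧ HasVertex F (b - 1)) := Iff.rfl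

theorem mem_coneComplex_pathComplex {a b : ℕ} {v : Fin n} {F : Finset (Fin n)} :
    F ∈ coneComplex v (pathComplex n a b) ↔ ∀ k : ℕ, k ≠ v → HasVertex F k →
      a ≤ k ∧ k < b ∧ ¬ (k + 1 ≠ v ∧ HasVertex F (k + 1)) := by
  simp only [mem_coneComplex, mem_pathComplex, hasVertex_erase, and_imp]

theorem notMem_of_mem_pathComplex {a b : ℕ} {v : Fin n} (hv : v < a ∨ b ≤ (v : ℕ)) :
    ∀ F ∈ pathComplex n a b, v ∉ F := by
  intro F hF hvF
  have := hF v (hasVertex_coe.2 hvF)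
  omega

/-- A maximal independent set of a path contains the first or the second vertex, so the stars of
these two vertices cover the complex. -/
theorem pathComplex_eq_sup {a b : ℕ} (hb : b ≤ n) (hab : a + 2 ≤ b) :
    pathComplex n a b = coneComplex ⟨a, by omega⟩ (pathComplex n (a + 2) b) ⊔
      coneComplex ⟨a + 1, by omega⟩ (pathComplex n (a + 3) b) := by
  ext F
  simp only [LowerSet.coe_sup, Set.mem_union, SetLike.mem_coe, mem_coneComplex_pathComplex,
    mem_pathComplex]
  generalize HasVertex F = P
  constructor
  · intro h
    by_cases h1 : P (a + 1)
    · right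
      grind
    · left
      grind
  · rintro (h | h) <;> grind

theorem coneComplex_inf_coneComplex_pathComplex {a b : ℕ} (hb : b ≤ n) (hab : a + 2 ≤ b) :
    coneComplex ⟨a, by omega⟩ (pathComplex n (a + 2) b) ⊓
      coneComplex ⟨a + 1, by omega⟩ (pathComplex n (a + 3) b) = pathComplex n (a + 3) b := by
  ext F
  simp only [LowerSet.coe_inf, Set.mem_inter_iff, SetLike.mem_coe, mem_coneComplex_pathComplex,
    mem_pathComplex]
  generalize HasVertex F = P
  grind

theorem pathComplex_succ_self {a : ℕ} (ha : a < n) :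
    pathComplex n a (a + 1) = coneComplex ⟨a, ha⟩ (pathComplex n (a + 1) (a + 1)) := by
  ext F
  simp only [SetLike.mem_coe, mem_coneComplex_pathComplex, mem_pathComplex]
  generalize HasVertex F = P
  grind

theorem cycleComplex_eq_star_sup_deletion {a b : ℕ} (hb : b ≤ n) (hab : a + 3 ≤ b) :
    cycleComplex n a b = coneComplex ⟨a, by omega⟩ (pathComplex n (a + 2) (b - 1)) ⊔
      pathComplex n (a + 1) b := by
  ext F
  simp only [LowerSet.coe_sup, Set.mem_union, SetLike.mem_coe, mem_coneComplex_pathComplex,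
    mem_pathComplex, mem_cycleComplex]
  generalize HasVertex F = P
  grind

theorem star_inf_deletion {a b : ℕ} (hb : b ≤ n) (hab : a + 3 ≤ b) :
    coneComplex ⟨a, by omega⟩ (pathComplex n (a + 2) (b - 1)) ⊓ pathComplex n (a + 1) b =
      pathComplex n (a + 2) (b - 1) := by
  ext F
  simp only [LowerSet.coe_inf, Set.mem_inter_iff, SetLike.mem_coe, mem_coneComplex_pathComplex,
    mem_pathComplex]
  generalize HasVertex F = P
  grind

/-- A maximal independent set that omits a must contain one of its neighbours a + 1 and b - 1. -/
theorem cycleComplex_eq_sup_stars {a b : ℕ} (hb : b ≤ n) (hab : a + 3 ≤ b) :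
    cycleComplex n a b = coneComplex ⟨a, by omega⟩ (pathComplex n (a + 2) (b - 1)) ⊔
      (coneComplex ⟨a + 1, by omega⟩ (pathComplex n (a + 3) b) ⊔
        coneComplex ⟨b - 1, by omega⟩ (pathComplex n (a + 1) (b - 2))) := by
  ext F
  simp only [LowerSet.coe_sup, Set.mem_union, SetLike.mem_coe, mem_coneComplex_pathComplex,
    mem_cycleComplex]
  generalize HasVertex F = P
  constructor
  · rintro ⟨h, h'⟩
    by_cases ha : P a
    · left
      grind
    by_cases h1 : P (a + 1)
    · right; left
      intro k hk hP
      obtain ⟨hak, hkb, hk1⟩ := h k hP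
      have hka : k ≠ a := fun e => ha (e ▸ hP)
      have hk2 : k ≠ a + 2 := fun e => (h _ h1).2.2 (e ▸ hP)
      exact ⟨by omega, hkb, fun e => hk1 e.2⟩
    by_cases h2 : P (b - 1)
    · right; right
      grind
    · left
      grind
  · rintro (h | h | h) <;> grind

/-- What remains are independent sets on a + 2, …, b - 2 that omit at least one end, as if the ends
were joined by an edge: a cycle with three fewer vertices. This drives the nonvanishing induction.
-/
theorem star_inf_sup_stars {a b : ℕ} (hb : b ≤ n) (hab : a + 3 ≤ b) :
    coneComplex ⟨a, by omega⟩ (pathComplex n (a + 2) (b - 1)) ⊓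
      (coneComplex ⟨a + 1, by omega⟩ (pathComplex n (a + 3) b) ⊔
        coneComplex ⟨b - 1, by omega⟩ (pathComplex n (a + 1) (b - 2))) =
      cycleComplex n (a + 2) (b - 1) := by
  ext F
  simp only [LowerSet.coe_sup, Set.mem_union, LowerSet.coe_inf, Set.mem_inter_iff, SetLike.mem_coe,
    mem_coneComplex_pathComplex, mem_cycleComplex]
  generalize HasVertex F = P
  grind

/-- With at least four vertices, a + 1 and b - 1 are distinct and nonadjacent, so the intersection
is a double cone; for a triangle they are adjacent and this fails. -/
theorem star_inf_star {a b : ℕ} (hb : b ≤ n) (hab : a + 4 ≤ b) :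
    coneComplex ⟨a + 1, by omega⟩ (pathComplex n (a + 3) b) ⊓
        coneComplex ⟨b - 1, by omega⟩ (pathComplex n (a + 1) (b - 2)) =
      coneComplex ⟨a + 1, by omega⟩
        (coneComplex ⟨b - 1, by omega⟩ (pathComplex n (a + 3) (b - 2))) := by
  ext F
  simp only [LowerSet.coe_inf, Set.mem_inter_iff, SetLike.mem_coe, mem_coneComplex,
    mem_pathComplex, hasVertex_erase]
  generalize HasVertex F = P
  grind

theorem cycleComplex_add_two {a : ℕ} (ha : a + 2 ≤ n) :
    cycleComplex n a (a + 2) = coneComplex ⟨a, by omega⟩ (pathComplex n (a + 2) (a + 2)) ⊔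
      coneComplex ⟨a + 1, by omega⟩ (pathComplex n (a + 2) (a + 2)) := by
  ext F
  simp only [LowerSet.coe_sup, Set.mem_union, SetLike.mem_coe, mem_coneComplex_pathComplex,
    mem_cycleComplex]
  generalize HasVertex F = P
  grind

theorem eq_empty_iff_not_hasVertex {F : Finset (Fin n)} : F = ∅ ↔ ∀ k, ¬ HasVertex F k := by
  simp [Finset.eq_empty_iff_forall_notMem, HasVertex]

theorem mem_coneComplex_inf_coneComplex_iff {a : ℕ} (ha : a + 2 ≤ n) (F : Finset (Fin n)) :
    F ∈ coneComplex ⟨a, by omega⟩ (pathComplex n (a + 2) (a + 2)) ⊓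
      coneComplex ⟨a + 1, by omega⟩ (pathComplex n (a + 2) (a + 2)) ↔ F = ∅ := by
  simp only [LowerSet.mem_inf_iff, mem_coneComplex_pathComplex, eq_empty_iff_not_hasVertex]
  generalize HasVertex F = P
  grind

/-- Base case of the induction: a cycle of length one behaves as a loop, which excludes its only
vertex. -/
theorem mem_cycleComplex_iff_eq_empty {a b : ℕ} (hab : b ≤ a + 1) (F : Finset (Fin n)) :
    F ∈ cycleComplex n a b ↔ F = ∅ := by
  simp only [mem_cycleComplex, eq_empty_iff_not_hasVertex]
  generalize HasVertex F = P
  grind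

/-! ### The depth of the cycle ring. -/

variable {K : Type u} [Field K]

/-- The bound says d ≤ ⌈(b - a)/3⌉. The stars of the first two vertices meet in the path shorter by
three, which costs one degree. -/
theorem faceExtVanishesBelow_pathComplex {d : ℕ} : ∀ {a b : ℕ}, b ≤ n → 3 * d ≤ b - a + 2 →
    FaceExtVanishesBelow K (pathComplex n a b) d := by
  induction d with
  | zero => exact fun _ _ => .zero _
  | succ d ih =>
    intro a b hb hd
    obtain rfl | hab : b = a + 1 ∨ a + 2 ≤ b := by omega
    · rw [pathComplex_succ_self (by omega)]
      exact (ih hb (by omega)).cone (notMem_of_mem_pathComplex (Or.inl (by simp)))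
    · rw [pathComplex_eq_sup hb hab]
      refine .sup ?_ ?_ ?_
      · exact (ih hb (by omega)).cone (notMem_of_mem_pathComplex (Or.inl (by simp)))
      · exact (ih hb (by omega)).cone (notMem_of_mem_pathComplex (Or.inl (by simp)))
      · rw [coneComplex_inf_coneComplex_pathComplex hb hab]
        exact ih hb (by omega)

theorem faceExtVanishesBelow_cycleComplex {a b d : ℕ} (hb : b ≤ n) (hab : a + 3 ≤ b)
    (hd : 3 * d ≤ b - a + 1) : FaceExtVanishesBelow K (cycleComplex n a b) d := by
  cases d with
  | zero => exact .zero _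
  | succ d =>
    rw [cycleComplex_eq_star_sup_deletion hb hab]
    refine .sup ?_ (faceExtVanishesBelow_pathComplex hb (by omega)) ?_
    · exact (faceExtVanishesBelow_pathComplex (by omega) (by omega)).cone
        (notMem_of_mem_pathComplex (Or.inl (by simp)))
    · rw [star_inf_deletion hb hab]
      exact faceExtVanishesBelow_pathComplex (by omega) (by omega)

theorem faceExtVanishesBelow_star_sup_star {a b d : ℕ} (hb : b ≤ n) (hab : a + 3 ≤ b)
    (hd : 3 * d ≤ b - a - 1) :
    FaceExtVanishesBelow K (coneComplex ⟨a + 1, by omega⟩ (pathComplex n (a + 3) b) ⊔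
        coneComplex ⟨b - 1, by omega⟩ (pathComplex n (a + 1) (b - 2))) (d + 1) := by
  refine .sup ?_ ?_ ?_
  · exact (faceExtVanishesBelow_pathComplex hb (by omega)).cone
      (notMem_of_mem_pathComplex (Or.inl (by simp)))
  · exact (faceExtVanishesBelow_pathComplex (by omega) (by omega)).cone
      (notMem_of_mem_pathComplex (Or.inr (by simp; omega)))
  · obtain rfl | hab' : b = a + 3 ∨ a + 4 ≤ b := by omega
    · obtain rfl : d = 0 := by omega
      exact .zero _
    · rw [star_inf_star hb hab']
      -- The two apices contribute one degree each, so vanishing below d - 2 on the inner path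
      -- suffices; truncated subtraction is harmless since d ≤ d - 2 + 2.
      refine FaceExtVanishesBelow.mono (d := d - 2 + 1 + 1) (.cone ?_ (.cone ?_ ?_)) (by omega)
      · intro F hF hmem
        rw [mem_coneComplex_pathComplex] at hF
        have := hF (a + 1) (by simp; omega) (hasVertex_coe.2 hmem)
        omega
      · exact notMem_of_mem_pathComplex (Or.inr (by simp; omega))
      · exact faceExtVanishesBelow_pathComplex (by omega) (by omega)

theorem faceExtNontrivial_cycleComplex (L : ℕ) : ∀ {a : ℕ}, a + L ≤ n →
    FaceExtNontrivial K (cycleComplex n a (a + L)) ((L + 1) / 3) := by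
  induction L using Nat.strong_induction_on with
  | _ L ih =>
    intro a ha
    obtain hL | rfl | hL : L ≤ 1 ∨ L = 2 ∨ 3 ≤ L := by omega
    · rw [show (L + 1) / 3 = 0 by omega]
      exact .zero (mem_cycleComplex_iff_eq_empty (by omega))
    · rw [cycleComplex_add_two ha]
      refine FaceExtNontrivial.sup (d := 0) ?_ ?_
        (.zero (mem_coneComplex_inf_coneComplex_iff ha)) <;>
      exact (FaceExtVanishesBelow.zero _).cone (notMem_of_mem_pathComplex (Or.inl (by simp)))
    · rw [cycleComplex_eq_sup_stars ha (by omega),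
        show (L + 1) / 3 = (L - 3 + 1) / 3 + 1 by omega]
      refine FaceExtNontrivial.sup ?_
        (faceExtVanishesBelow_star_sup_star ha (by omega) (by omega)) ?_
      · exact (faceExtVanishesBelow_pathComplex (by omega) (by omega)).cone
          (notMem_of_mem_pathComplex (Or.inl (by simp)))
      · rw [star_inf_sup_stars ha (by omega),
          show a + L - 1 = a + 2 + (L - 3) by omega]
        exact ih (L - 3) (by omega) (by omega)

theorem moduleDepth_cycleComplex (hn : 3 ≤ n) :
    moduleDepth (idealOfVars (Fin n) K)
      (MvPolynomial (Fin n) K ⧸ stanleyReisnerIdeal K (cycleComplex n 0 n)) =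
        ((n + 1) / 3 : ℕ) := by
  refine moduleDepth_eq_of_face_ext ?_ ?_ ?_
  · rw [mem_cycleComplex]
    simp [HasVertex]
  · exact faceExtVanishesBelow_cycleComplex le_rfl (by omega) (by omega)
  · simpa using faceExtNontrivial_cycleComplex (K := K) n (a := 0) (by omega)

end PathsAndCycles

/-! ### Associated primes, dimensions and heights from facets. -/

section Primes

open MvPolynomial

universe u

variable (K : Type u) [Field K] {n : ℕ}

/-- The prime ideal generated by the variables outside `W`. -/
noncomputable def facePrime (W : Finset (Fin n)) : Ideal (MvPolynomial (Fin n) K) :=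
  Ideal.span (X '' {i | i ∉ W})

variable {K}

theorem mem_facePrime {W : Finset (Fin n)} {f : MvPolynomial (Fin n) K} :
    f ∈ facePrime K W ↔ ∀ m ∈ f.support, ¬ m.support ⊆ W := by
  rw [facePrime, mem_ideal_span_X_image]
  simp only [Set.mem_ofPred_eq, Finset.not_subset, Finsupp.mem_support_iff]
  grind

/-- Setting the variables outside W to zero presents the quotient as a polynomial ring on W, which
gives both primality and dimension. -/
theorem ker_killCompl_subtype (W : Finset (Fin n)) :
    RingHom.ker (killCompl (R := K) (Subtype.val_injective (p := (· ∈ W)))) = facePrime K W := by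
  ext f
  rw [RingHom.mem_ker, mem_facePrime, ← support_eq_empty, support_killCompl,
    Finset.eq_empty_iff_forall_notMem]
  constructor
  · intro h m hm hmW
    apply h (m.comapDomain Subtype.val Subtype.val_injective.injOn)
    rw [Finset.mem_preimage, Finsupp.mapDomain_comapDomain _ Subtype.val_injective]
    · exact hm
    · simpa [Set.subset_def, Finset.subset_iff] using hmW
  · intro h s hs
    refine h _ (Finset.mem_preimage.1 hs) (Finsupp.mapDomain_support.trans fun i hi => ?_)
    obtain ⟨j, -, rfl⟩ := Finset.mem_image.1 hi
    exact j.2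

theorem killCompl_surjective {σ τ R : Type*} [CommSemiring R] {f : σ → τ}
    (hf : Function.Injective f) : Function.Surjective (killCompl (R := R) hf) :=
  fun p => ⟨rename f p, killCompl_rename_app hf p⟩

/-- The quotient by the prime of a face is the polynomial ring on the vertices of the face. -/
noncomputable def quotientFacePrimeEquiv (W : Finset (Fin n)) :
    (MvPolynomial (Fin n) K ⧸ facePrime K W) ≃+* MvPolynomial W K :=
  (Ideal.quotEquivOfEq (ker_killCompl_subtype W).symm).trans
    (RingHom.quotientKerEquivOfSurjective (f := (killCompl (R := K)
      (Subtype.val_injective (p := (· ∈ W)))).toRingHom) (killCompl_surjective _))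

instance facePrime_isPrime (W : Finset (Fin n)) : (facePrime K W).IsPrime := by
  rw [← ker_killCompl_subtype]
  exact RingHom.ker_isPrime _

theorem ringKrullDim_quotient_facePrime (W : Finset (Fin n)) :
    ringKrullDim (MvPolynomial (Fin n) K ⧸ facePrime K W) = (W.card : ℕ∞) := by
  rw [ringKrullDim_eq_of_ringEquiv (quotientFacePrimeEquiv W),
    MvPolynomial.ringKrullDim_of_isNoetherianRing, ringKrullDim_eq_zero_of_field]
  simp

theorem facePrime_lt_of_ssubset {W U : Finset (Fin n)} (h : W ⊂ U) :
    facePrime K U < facePrime K W := by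
  obtain ⟨hWU, hUW⟩ := h
  obtain ⟨i, hiU, hiW⟩ := Finset.not_subset.1 hUW
  refine lt_of_le_not_ge (fun f hf => ?_) (fun hle => ?_)
  · rw [mem_facePrime] at hf ⊢
    exact fun m hm hmW => hf m hm (hmW.trans hWU)
  · have := hle (Ideal.subset_span ⟨i, hiW, rfl⟩)
    rw [mem_facePrime] at this
    refine this (Finsupp.single i 1) (by simp [X]) ?_
    exact Finsupp.support_single_subset.trans (by simpa using hiU)

/-- Adding the missing vertices to W one at a time gives a strictly descending chain of primes.
Krull's height theorem supplies the reverse bound. -/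
theorem le_height_facePrime (c : ℕ) : ∀ W : Finset (Fin n), Wᶜ.card = c →
    (c : ℕ∞) ≤ (facePrime K W).height := by
  induction c with
  | zero => simp
  | succ c ih =>
    intro W hW
    obtain ⟨i, hi⟩ : (Wᶜ).Nonempty := Finset.card_pos.1 (by omega)
    have hiW := Finset.mem_compl.1 hi
    have hc : (insert i W)ᶜ.card = c := by
      rw [Finset.compl_insert, Finset.card_erase_of_mem hi, hW, Nat.add_sub_cancel]
    have := Ideal.height_add_one_le_of_lt_of_isPrime
      (facePrime_lt_of_ssubset (K := K) (Finset.ssubset_insert hiW))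
    refine le_trans ?_ this
    push_cast
    gcongr
    exact ih _ hc

theorem height_facePrime (W : Finset (Fin n)) : (facePrime K W).height = Wᶜ.card := by
  classical
  apply le_antisymm _ (le_height_facePrime _ W rfl)
  have h : facePrime K W = Ideal.span ((Wᶜ.image X : Finset (MvPolynomial (Fin n) K)) : Set _) := by
    rw [facePrime]
    congr 1
    ext
    simp
  have hmin : facePrime K W ∈
      (Ideal.span ((Wᶜ.image X : Finset (MvPolynomial (Fin n) K)) : Set _)).minimalPrimes := by
    rw [← h, Ideal.minimalPrimes_eq_subsingleton_self]
    rfl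
  refine (Ideal.height_le_card_of_mem_minimalPrimes_span_finset hmin).trans ?_
  exact_mod_cast Finset.card_image_le

theorem stanleyReisnerIdeal_le_facePrime {Δ : LowerSet (Finset (Fin n))} {W : Finset (Fin n)}
    (hW : W ∈ Δ) : stanleyReisnerIdeal K Δ ≤ facePrime K W := by
  intro f hf
  rw [mem_stanleyReisnerIdeal] at hf
  rw [mem_facePrime]
  exact fun m hm hmW => hf m hm (Δ.lower hmW hW)

theorem mem_stanleyReisnerIdeal_iff_facets {Δ : LowerSet (Finset (Fin n))}
    {f : MvPolynomial (Fin n) K} :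
    f ∈ stanleyReisnerIdeal K Δ ↔ ∀ W, Maximal (· ∈ Δ) W → f ∈ facePrime K W := by
  refine ⟨fun hf W hW => stanleyReisnerIdeal_le_facePrime hW.prop hf, fun h => ?_⟩
  rw [mem_stanleyReisnerIdeal]
  intro m hm hmΔ
  obtain ⟨W, hmW, hW⟩ := (Set.toFinite {F | F ∈ Δ}).exists_le_maximal hmΔ
  exact mem_facePrime.1 (h W hW) m hm hmW

/-- A prime that contains `(I_Δ : f)` contains the prime of a facet that does not contain `f`. -/
theorem exists_facePrime_le {Δ : LowerSet (Finset (Fin n))} {f : MvPolynomial (Fin n) K}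
    {p : Ideal (MvPolynomial (Fin n) K)} (hp : p.IsPrime)
    (h : ∀ r, r * f ∈ stanleyReisnerIdeal K Δ → r ∈ p) :
    ∃ W, Maximal (· ∈ Δ) W ∧ f ∉ facePrime K W ∧ facePrime K W ≤ p := by
  classical
  -- An element of all facet primes that avoid f multiplies f into every facet prime, hence into
  -- I_Δ. A prime containing a finite intersection of ideals contains one of them.
  have hle : (Finset.univ.filter fun W => Maximal (· ∈ Δ) W ∧ f ∉ facePrime K W).inf
      (facePrime K) ≤ p := by
    intro r hr
    rw [Submodule.mem_finsetInf] at hr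
    refine h r (mem_stanleyReisnerIdeal_iff_facets.2 fun W hW => ?_)
    by_cases hf : f ∈ facePrime K W
    · exact Ideal.mul_mem_left _ _ hf
    · exact Ideal.mul_mem_right _ _ (hr W (by simp [hW, hf]))
  obtain ⟨W, hW, hWp⟩ := hp.inf_le'.1 hle
  rw [Finset.mem_filter] at hW
  exact ⟨W, hW.2.1, hW.2.2, hWp⟩

theorem facePrime_mem_minimalPrimes {Δ : LowerSet (Finset (Fin n))} {W : Finset (Fin n)}
    (hW : Maximal (· ∈ Δ) W) : facePrime K W ∈ (stanleyReisnerIdeal K Δ).minimalPrimes := by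
  refine ⟨⟨inferInstance, stanleyReisnerIdeal_le_facePrime hW.prop⟩, ?_⟩
  rintro q ⟨hq, hle⟩ hqW
  obtain ⟨U, hU, -, hUq⟩ := exists_facePrime_le (f := 1) hq
    (fun r hr => hle (by simpa using hr))
  have hWU : W ⊆ U := by
    intro i hi
    by_contra hiU
    have := hqW (hUq (Ideal.subset_span ⟨i, hiU, rfl⟩))
    rw [mem_facePrime] at this
    exact this (Finsupp.single i 1) (by simp [X])
      (Finsupp.support_single_subset.trans (by simpa using hi))
  obtain rfl : W = U := le_antisymm hWU (hW.le_of_ge hU.prop hWU)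
  exact hUq

theorem mem_minimalPrimes_stanleyReisnerIdeal {Δ : LowerSet (Finset (Fin n))}
    {p : Ideal (MvPolynomial (Fin n) K)} :
    p ∈ (stanleyReisnerIdeal K Δ).minimalPrimes ↔ ∃ W, Maximal (· ∈ Δ) W ∧ p = facePrime K W := by
  refine ⟨fun hp => ?_, ?_⟩
  · obtain ⟨W, hW, -, hWp⟩ := exists_facePrime_le (f := 1) hp.1.1
      (fun r hr => hp.1.2 (by simpa using hr))
    exact ⟨W, hW, le_antisymm
      (hp.2 ⟨inferInstance, stanleyReisnerIdeal_le_facePrime hW.prop⟩ hWp) hWp⟩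
  · rintro ⟨W, hW, rfl⟩
    exact facePrime_mem_minimalPrimes hW

theorem mem_associatedPrimes_stanleyReisnerIdeal {Δ : LowerSet (Finset (Fin n))}
    {p : Ideal (MvPolynomial (Fin n) K)} :
    p ∈ associatedPrimes (MvPolynomial (Fin n) K)
        (MvPolynomial (Fin n) K ⧸ stanleyReisnerIdeal K Δ) ↔
      ∃ W, Maximal (· ∈ Δ) W ∧ p = facePrime K W := by
  constructor
  · intro hp
    rw [AssociatedPrimes.mem_iff, isAssociatedPrime_iff] at hp
    obtain ⟨hprime, x, hx⟩ := hp
    obtain ⟨f, rfl⟩ := Submodule.Quotient.mk_surjective _ x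
    have hmem : ∀ r, r ∈ p ↔ r * f ∈ stanleyReisnerIdeal K Δ := by
      intro r
      rw [hx, Submodule.mem_colon_singleton, ← Submodule.Quotient.mk_smul, Submodule.mem_bot,
        Submodule.Quotient.mk_eq_zero, smul_eq_mul]
    obtain ⟨W, hW, hfW, hWp⟩ := exists_facePrime_le hprime fun r hr => (hmem r).2 hr
    refine ⟨W, hW, le_antisymm (fun r hr => ?_) hWp⟩
    have := stanleyReisnerIdeal_le_facePrime hW.prop ((hmem r).1 hr)
    exact ((facePrime_isPrime W).mem_or_mem this).resolve_right hfW
  · rintro ⟨W, hW, rfl⟩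
    apply Module.associatedPrimes.minimalPrimes_annihilator_subset_associatedPrimes
    rw [Ideal.annihilator_quotient]
    exact facePrime_mem_minimalPrimes hW

theorem moduleMdepth_stanleyReisnerIdeal (Δ : LowerSet (Finset (Fin n))) :
    moduleMdepth (MvPolynomial (Fin n) K) (MvPolynomial (Fin n) K ⧸ stanleyReisnerIdeal K Δ) =
      ⨅ (W : Finset (Fin n)) (_ : Maximal (· ∈ Δ) W), ((W.card : ℕ∞) : WithBot ℕ∞) := by
  apply le_antisymm
  · refine le_iInf₂ fun W hW => ?_
    rw [← ringKrullDim_quotient_facePrime (K := K)]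
    exact iInf₂_le _ (mem_associatedPrimes_stanleyReisnerIdeal.2 ⟨W, hW, rfl⟩)
  · refine le_iInf₂ fun p hp => ?_
    obtain ⟨W, hW, rfl⟩ := mem_associatedPrimes_stanleyReisnerIdeal.1 hp
    rw [ringKrullDim_quotient_facePrime]
    exact iInf₂_le W hW

theorem bigHeight_stanleyReisnerIdeal (Δ : LowerSet (Finset (Fin n))) :
    bigHeight (stanleyReisnerIdeal K Δ) =
      ⨆ (W : Finset (Fin n)) (_ : Maximal (· ∈ Δ) W), (Wᶜ.card : ℕ∞) := by
  apply le_antisymm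
  · refine iSup₂_le fun p hp => ?_
    obtain ⟨W, hW, rfl⟩ := mem_minimalPrimes_stanleyReisnerIdeal.1 hp
    rw [height_facePrime]
    exact le_iSup₂ (f := fun (W : Finset (Fin n)) (_ : Maximal (· ∈ Δ) W) => (Wᶜ.card : ℕ∞)) W hW
  · refine iSup₂_le fun W hW => ?_
    rw [← height_facePrime (K := K)]
    exact le_iSup₂ (f := fun (p : Ideal (MvPolynomial (Fin n) K))
      (_ : p ∈ (stanleyReisnerIdeal K Δ).minimalPrimes) => p.height) _
      (facePrime_mem_minimalPrimes hW)

end Primes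

/-! ### The edge ideal of the cycle and the sizes of its facets. -/

section CycleGraph

open MvPolynomial SimpleGraph

universe u

variable {n : ℕ}

theorem cycleGraph_adj_iff_val (hn : 3 ≤ n) {u v : Fin n} :
    (cycleGraph n).Adj u v ↔ (u : ℕ) + 1 = v ∨ (v : ℕ) + 1 = u ∨
      ((u : ℕ) = 0 ∧ (v : ℕ) + 1 = n) ∨ ((v : ℕ) = 0 ∧ (u : ℕ) + 1 = n) := by
  rw [cycleGraph_adj']
  have hu := u.isLt
  have hv := v.isLt
  rcases lt_trichotomy u v with h | h | h
  · rw [Fin.coe_sub_iff_lt.2 h, Fin.coe_sub_iff_le.2 h.le]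
    rw [Fin.lt_def] at h
    omega
  · subst h
    rw [Fin.coe_sub_iff_le.2 le_rfl]
    omega
  · rw [Fin.coe_sub_iff_lt.2 h, Fin.coe_sub_iff_le.2 h.le]
    rw [Fin.lt_def] at h
    omega

theorem mem_cycleComplex_iff_not_adj (hn : 3 ≤ n) {F : Finset (Fin n)} :
    F ∈ cycleComplex n 0 n ↔ ∀ i ∈ F, ∀ j ∈ F, ¬ (cycleGraph n).Adj i j := by
  rw [mem_cycleComplex]
  simp only [cycleGraph_adj_iff_val hn]
  constructor
  · rintro ⟨h, h0⟩ i hi j hj hij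
    have hi' := hasVertex_coe.2 hi
    have hj' := hasVertex_coe.2 hj
    rcases hij with e | e | ⟨e, e'⟩ | ⟨e, e'⟩
    · exact (h i hi').2.2 (e ▸ hj')
    · exact (h j hj').2.2 (e ▸ hi')
    · exact h0 ⟨e ▸ hi', (show (j : ℕ) = n - 1 by omega) ▸ hj'⟩
    · exact h0 ⟨e ▸ hj', (show (i : ℕ) = n - 1 by omega) ▸ hi'⟩
  · intro h
    constructor
    · rintro _ ⟨i, hi, rfl⟩
      refine ⟨Nat.zero_le _, i.isLt, ?_⟩
      rintro ⟨j, hj, hij⟩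
      exact h i hi j hj (by omega)
    · rintro ⟨⟨i, hi, hi0⟩, ⟨j, hj, hj0⟩⟩
      exact h i hi j hj (by omega)

theorem edgeIdeal_cycleGraph (K : Type u) [Field K] (hn : 3 ≤ n) :
    edgeIdeal K (cycleGraph n) = stanleyReisnerIdeal K (cycleComplex n 0 n) := by
  apply le_antisymm
  · rw [edgeIdeal, Ideal.span_le]
    rintro _ ⟨i, j, hij, rfl⟩
    have hX : (X i * X j : MvPolynomial (Fin n) K) =
        monomial (Finsupp.single i 1 + Finsupp.single j 1) 1 := by
      rw [X, X, monomial_mul, one_mul]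
    rw [hX]
    refine monomial_mem_stanleyReisnerIdeal fun h => ?_
    exact (mem_cycleComplex_iff_not_adj hn).1 h i (by simp) j (by simp) hij
  · refine stanleyReisnerIdeal_le fun m hm => ?_
    rw [mem_cycleComplex_iff_not_adj hn] at hm
    push Not at hm
    obtain ⟨i, hi, j, hj, hij⟩ := hm
    have hX : (X i * X j : MvPolynomial (Fin n) K) =
        monomial (Finsupp.single i 1 + Finsupp.single j 1) 1 := by
      rw [X, X, monomial_mul, one_mul]
    have hmem : (X i * X j : MvPolynomial (Fin n) K) ∈ edgeIdeal K (cycleGraph n) :=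
      Ideal.subset_span ⟨i, j, hij, rfl⟩
    refine Ideal.mem_of_dvd _ ?_ hmem
    rw [hX, monomial_dvd_monomial]
    refine ⟨Or.inr fun k => ?_, dvd_rfl⟩
    rw [Finsupp.mem_support_iff] at hi hj
    -- As i ≠ j, all exponents of x_i x_j are at most one, so divisibility only needs i and j in the
    -- support of m.
    have hne := hij.ne
    simp only [Finsupp.add_apply, Finsupp.single_apply]
    split_ifs <;> subst_vars <;> omega

/-- A maximal independent set is dominating, and each of its vertices dominates only itself and its
two neighbours. -/
theorem le_three_mul_card_of_facet (hn : 3 ≤ n) {W : Finset (Fin n)}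
    (hW : Maximal (· ∈ cycleComplex n 0 n) W) : n ≤ 3 * W.card := by
  have hcover : (Finset.univ : Finset (Fin n)) ⊆
      W.biUnion fun w => insert w ((cycleGraph n).neighborFinset w) := by
    intro v _
    rw [Finset.mem_biUnion]
    by_contra! h
    simp only [Finset.mem_insert, mem_neighborFinset, not_or] at h
    have hvW : v ∉ W := fun hv => (h v hv).1 rfl
    refine hvW (hW.le_of_ge (y := insert v W) ?_ (Finset.subset_insert _ _)
      (Finset.mem_insert_self _ _))
    rw [mem_cycleComplex_iff_not_adj hn]
    have hind := (mem_cycleComplex_iff_not_adj hn).1 hW.prop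
    intro i hi j hj hij
    rw [Finset.mem_insert] at hi hj
    rcases hi with rfl | hi <;> rcases hj with rfl | hj
    · exact hij.ne rfl
    · exact (h j hj).2 hij.symm
    · exact (h i hi).2 hij
    · exact hind i hi j hj hij
  obtain ⟨k, rfl⟩ : ∃ k, n = k + 3 := ⟨n - 3, by omega⟩
  have hcard := (Finset.card_le_card hcover).trans
    (Finset.card_biUnion_le_card_mul W _ 3 fun w _ => by
      refine (Finset.card_insert_le _ _).trans ?_
      rw [card_neighborFinset_eq_degree, cycleGraph_degree_three_le])
  rw [Finset.card_univ, Fintype.card_fin] at hcard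
  omega

/-- If `n ≢ 1 (mod 3)`, the vertices divisible by three form a facet. -/
theorem maximal_filter_three_dvd (hn : 3 ≤ n) (h1 : n % 3 ≠ 1) :
    Maximal (· ∈ cycleComplex n 0 n) (Finset.univ.filter fun i : Fin n => 3 ∣ (i : ℕ)) := by
  refine ⟨(mem_cycleComplex_iff_not_adj hn).2 ?_, fun U hU hle i hi => ?_⟩
  · intro i hi j hj
    simp only [Finset.mem_filter, Finset.mem_univ, true_and] at hi hj
    rw [cycleGraph_adj_iff_val hn]
    omega
  · replace hU := (mem_cycleComplex_iff_not_adj hn).1 hU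
    simp only [Finset.mem_filter, Finset.mem_univ, true_and]
    by_contra hdvd
    have hin := i.isLt
    have key : ∀ j : Fin n, 3 ∣ (j : ℕ) → ¬ (cycleGraph n).Adj i j := fun j hj =>
      hU i hi j (hle (by simpa using hj))
    simp only [cycleGraph_adj_iff_val hn] at key
    -- Every other vertex has a neighbour divisible by three: i - 1 or i + 1 according to the
    -- residue, or 0 if i is the last vertex.
    obtain hr | hr : (i : ℕ) % 3 = 1 ∨ (i : ℕ) % 3 = 2 := by omega
    · exact key ⟨i - 1, by omega⟩ (by simp only; omega) (Or.inr (Or.inl (by simp only; omega)))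
    · by_cases hlast : (i : ℕ) + 1 = n
      · exact key ⟨0, by omega⟩ (by simp) (Or.inr (Or.inr (Or.inr ⟨rfl, hlast⟩)))
      · exact key ⟨i + 1, by omega⟩ (by simp only; omega) (Or.inl rfl)

theorem card_filter_three_dvd :
    (Finset.univ.filter fun i : Fin n => 3 ∣ (i : ℕ)).card = (n + 2) / 3 := by
  have hinj : Set.InjOn (fun k => 3 * k) (Finset.range ((n + 2) / 3) : Set ℕ) :=
    fun a _ b _ h => by simpa using h
  rw [← Finset.card_image_of_injective _ Fin.val_injective]
  trans ((Finset.range ((n + 2) / 3)).image fun k => 3 * k).card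
  · congr 1
    ext k
    simp only [Finset.mem_image, Finset.mem_filter, Finset.mem_univ, true_and, Finset.mem_range]
    constructor
    · rintro ⟨i, ⟨c, hc⟩, rfl⟩
      have := i.isLt
      exact ⟨c, by omega, hc.symm⟩
    · rintro ⟨c, hc, rfl⟩
      exact ⟨⟨3 * c, by omega⟩, ⟨c, rfl⟩, rfl⟩
  · rw [Finset.card_image_of_injOn hinj, Finset.card_range]

end CycleGraph

/-! ### Comparison of depth with the least facet size. -/

theorem mainTheorem1 (K : Type*) [Field K] (n : ℕ) (hn : 3 ≤ n) :
    (HasMaximalDepth (MvPolynomial.idealOfVars (Fin n) K)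
        (MvPolynomial (Fin n) K ⧸ edgeIdeal K (SimpleGraph.cycleGraph n)) ↔
      n ≡ 0 [MOD 3] ∨ n ≡ 2 [MOD 3]) ∧
    (moduleDepth (MvPolynomial.idealOfVars (Fin n) K)
        (MvPolynomial (Fin n) K ⧸ edgeIdeal K (SimpleGraph.cycleGraph n)) +
        bigHeight (edgeIdeal K (SimpleGraph.cycleGraph n)) = n ↔
      n ≡ 0 [MOD 3] ∨ n ≡ 2 [MOD 3]) := by
  have hmod : (n ≡ 0 [MOD 3] ∨ n ≡ 2 [MOD 3]) ↔ n % 3 ≠ 1 := by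
    simp only [Nat.ModEq]
    omega
  have hcompl : ∀ W : Finset (Fin n), Wᶜ.card = n - W.card := fun W => by
    rw [Finset.card_compl, Fintype.card_fin]
  have hfacet : ∀ W : Finset (Fin n), Maximal (· ∈ cycleComplex n 0 n) W → (n + 2) / 3 ≤ W.card :=
    fun W hW => by
      have := le_three_mul_card_of_facet hn hW
      omega
  rw [hmod, HasMaximalDepth, edgeIdeal_cycleGraph K hn, moduleDepth_cycleComplex hn,
    moduleMdepth_stanleyReisnerIdeal, bigHeight_stanleyReisnerIdeal]
  have hmdepth : (((n + 2) / 3 : ℕ) : WithBot ℕ∞) ≤ ⨅ (W : Finset (Fin n))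
      (_ : Maximal (· ∈ cycleComplex n 0 n) W), ((W.card : ℕ∞) : WithBot ℕ∞) :=
    le_iInf₂ fun W hW => by exact_mod_cast hfacet W hW
  have hbight : (⨆ (W : Finset (Fin n)) (_ : Maximal (· ∈ cycleComplex n 0 n) W),
      (Wᶜ.card : ℕ∞)) ≤ (n - (n + 2) / 3 : ℕ) :=
    iSup₂_le fun W hW => by
      have := hfacet W hW
      rw [hcompl]
      exact_mod_cast (by omega : n - W.card ≤ n - (n + 2) / 3)
  refine ⟨⟨fun h h1 => ?_, fun h1 => ?_⟩, ⟨fun h h1 => ?_, fun h1 => ?_⟩⟩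
  -- For n ≡ 1 (mod 3), ⌊(n+1)/3⌋ is one less than ⌈n/3⌉, which is written (n + 2) / 3.
  · rw [← h] at hmdepth
    have : (n + 2) / 3 ≤ (n + 1) / 3 := by exact_mod_cast hmdepth
    omega
  · have hle := iInf₂_le (f := fun (W : Finset (Fin n))
      (_ : Maximal (· ∈ cycleComplex n 0 n) W) => ((W.card : ℕ∞) : WithBot ℕ∞)) _
      (maximal_filter_three_dvd hn h1)
    rw [card_filter_three_dvd] at hle
    rw [show (n + 1) / 3 = (n + 2) / 3 by omega]
    exact le_antisymm hmdepth hle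
  -- Replacing the big height by its upper bound `hbight` leaves a sum equal to n - 1 when n ≡ 1
  -- (mod 3).
  · have hle : (n : ℕ∞) ≤ ((n + 1) / 3 : ℕ) + (n - (n + 2) / 3 : ℕ) := by
      rw [← h]
      gcongr
    have : n ≤ (n + 1) / 3 + (n - (n + 2) / 3) := by exact_mod_cast hle
    omega
  · have hge := le_iSup₂ (f := fun (W : Finset (Fin n))
      (_ : Maximal (· ∈ cycleComplex n 0 n) W) => (Wᶜ.card : ℕ∞)) _
      (maximal_filter_three_dvd hn h1)
    rw [hcompl, card_filter_three_dvd] at hge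
    rw [le_antisymm hbight hge]
    exact_mod_cast (by omega : (n + 1) / 3 + (n - (n + 2) / 3) = n)
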